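/- \textbf{Proposition (four-corners Cantor measure).} Let $T_1,T_2,T_3,T_4$ be the homotheties of the plane of ratio $1/4$ centered at $(0,0)$, $(0,1)$, $(1,1)$, $(1,0)$, and let $\mu_K$ be the natural self-similar measure on the four-corner Cantor set $K$ (the attractor of $(T_1,\dots,T_4)$), that is, the unique Borel probability measure on $[0,1]^2$ with $$\mu_K=\tfrac14 (T_1)_*\mu_K+\tfrac14 (T_2)_*\mu_K+\tfrac14 (T_3)_*\mu_K+\tfrac14 (T_4)_*\mu_K .$$ For probability measures $\mu,\nu$ on $[0,1]^2$ put $$W_{1/2}(\mu,\nu)=\sup_f\Big|\int f\,d\mu-\int f\,d\nu\Big|,$$ the supremum being over all $f:[0,1]^2\to\mathbb{R}$ with $|f(x)-f(y)|\le\|x-y\|^{1/2}$ for all $x,y$, where $\|\cdot\|$ is the Euclidean norm. Let $(X_k)_{k\ge 0}$ be i.i.d. random points of law $\mu_K$ and let $\hat\mu_n=\frac1n\sum_{k=1}^n\delta_{X_k}$. Then $$\mathbb{E}\big[W_{1/2}(\hat\mu_n,\mu_K)\big]\asymp\frac{\log n}{\sqrt n},$$ i.e. there are absolute constants $0<c\le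 C<\infty$ such that for every integer $n\ge 2$ the random variable $W_{1/2}(\hat\mu_n,\mu_K)$ is integrable and $$c\,\frac{\log n}{\sqrt n}\;\le\;\mathbb{E}\big[W_{1/2}(\hat\mu_n,\mu_K)\big]\;\le\; C\,\frac{\log n}{\sqrt n}.$$ -/

import Mathlib

open MeasureTheory ProbabilityTheory
open scoped ENNReal

noncomputable section

namespace FourCorners

/-! ### The unit square and the four homotheties -/

/-- The unit square `[0,1]²` in the Euclidean plane. -/
def unitSquare : Set (EuclideanSpace ℝ (Fin 2)) := {x | ∀ j, x j ∈ Set.Icc (0 : ℝ) 1}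

/-- The four corners `(0,0)`, `(0,1)`, `(1,1)`, `(1,0)` of the unit square. -/
def corner : Fin 4 → EuclideanSpace ℝ (Fin 2) := ![!₂[0, 0], !₂[0, 1], !₂[1, 1], !₂[1, 0]]

lemma corner_mem (i : Fin 4) : corner i ∈ unitSquare := by
  intro j
  fin_cases i <;> fin_cases j <;> simp [corner]

lemma homothety_apply (i : Fin 4) (x : EuclideanSpace ℝ (Fin 2)) :
    AffineMap.homothety (corner i) (1 / 4 : ℝ) x = (3 / 4 : ℝ) • corner i + (1 / 4 : ℝ) • x := by
  rw [AffineMap.homothety_apply, vsub_eq_sub, vadd_eq_add]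
  module

lemma homothety_mem (i : Fin 4) {x : EuclideanSpace ℝ (Fin 2)} (hx : x ∈ unitSquare) :
    AffineMap.homothety (corner i) (1 / 4 : ℝ) x ∈ unitSquare := by
  intro j
  have h1 := corner_mem i j
  have h2 := hx j
  rw [homothety_apply]
  simp only [Set.mem_Icc, PiLp.add_apply, PiLp.smul_apply, smul_eq_mul] at *
  constructor <;> linarith [h1.1, h1.2, h2.1, h2.2]

/-- `T i` is the homothety of ratio `1/4` centered at the `i`-th corner, as a self-map of the
unit square. -/
def T (i : Fin 4) (x : unitSquare) : unitSquare :=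
  ⟨AffineMap.homothety (corner i) (1 / 4 : ℝ) (x : EuclideanSpace ℝ (Fin 2)),
    homothety_mem i x.2⟩

lemma T_coe (i : Fin 4) (x : unitSquare) :
    (T i x : EuclideanSpace ℝ (Fin 2)) = (3 / 4 : ℝ) • corner i + (1 / 4 : ℝ) • x.1 :=
  homothety_apply i x.1

lemma measurable_T (i : Fin 4) : Measurable (T i) := by
  refine Measurable.subtype_mk ?_
  simp only [homothety_apply]
  fun_prop

/-- The operator `ν ↦ ¼ (T₁)_* ν + ¼ (T₂)_* ν + ¼ (T₃)_* ν + ¼ (T₄)_* ν`. -/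
def transfer (ν : Measure unitSquare) : Measure unitSquare :=
  ∑ i : Fin 4, (1 / 4 : ℝ≥0∞) • ν.map (T i)

/-! ### Existence of the fixed probability measure -/

/-- The point of the plane with a given address. -/
def codeAux (w : ℕ → Fin 4) : EuclideanSpace ℝ (Fin 2) :=
  ∑' k, ((1 / 4 : ℝ) ^ k * (3 / 4)) • corner (w k)

lemma hasSum_weights : HasSum (fun k : ℕ => (1 / 4 : ℝ) ^ k * (3 / 4)) 1 := by
  have := (hasSum_geometric_of_lt_one (r := (1 / 4 : ℝ)) (by norm_num) (by norm_num)).mul_right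
    (3 / 4)
  have e : (1 - 1 / 4 : ℝ)⁻¹ * (3 / 4) = 1 := by norm_num
  rwa [e] at this

lemma norm_corner_le (i : Fin 4) : ‖corner i‖ ≤ 2 := by
  rw [EuclideanSpace.norm_eq, Real.sqrt_le_left (by norm_num), Fin.sum_univ_two]
  fin_cases i <;> simp [corner] <;> norm_num

lemma norm_term_le (k : ℕ) (i : Fin 4) :
    ‖((1 / 4 : ℝ) ^ k * (3 / 4)) • corner i‖ ≤ (1 / 4 : ℝ) ^ k * (3 / 4) * 2 := by
  rw [norm_smul, Real.norm_of_nonneg (by positivity)]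
  exact mul_le_mul_of_nonneg_left (norm_corner_le i) (by positivity)

lemma summable_code (w : ℕ → Fin 4) :
    Summable (fun k => ((1 / 4 : ℝ) ^ k * (3 / 4)) • corner (w k)) :=
  Summable.of_norm_bounded (hasSum_weights.summable.mul_right 2) fun k => norm_term_le k (w k)

lemma measurable_codeAux : Measurable codeAux := by
  have h : Continuous codeAux :=
    continuous_tsum (fun k => ((continuous_of_discreteTopology
      (f := fun i : Fin 4 => ((1 / 4 : ℝ) ^ k * (3 / 4)) • corner i)).comp (continuous_apply k)))
      (hasSum_weights.summable.mul_right 2) fun k w => norm_term_le k (w k)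
  exact h.measurable

lemma codeAux_mem (w : ℕ → Fin 4) : codeAux w ∈ unitSquare := by
  intro j
  have h : HasSum (fun k => (1 / 4 : ℝ) ^ k * (3 / 4) * corner (w k) j) (codeAux w j) := by
    have := (summable_code w).hasSum.mapL (EuclideanSpace.proj (𝕜 := ℝ) j)
    exact this
  refine ⟨h.nonneg fun k => ?_, hasSum_le (fun k => ?_) h hasSum_weights⟩
  · have := (corner_mem (w k) j).1
    positivity
  · exact mul_le_of_le_one_right (by positivity) (corner_mem (w k) j).2

/-- The point of the unit square with a given address. -/
def code (w : ℕ → Fin 4) : unitSquare := ⟨codeAux w, codeAux_mem w⟩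

lemma measurable_code : Measurable code := measurable_codeAux.subtype_mk

/-- Adding a first letter to an address. -/
def consWord (i : Fin 4) (w : ℕ → Fin 4) : ℕ → Fin 4 := fun k => Nat.casesOn k i w

lemma measurable_consWord (i : Fin 4) : Measurable (consWord i) := by
  refine measurable_pi_lambda _ fun k => ?_
  cases k with
  | zero => exact measurable_const
  | succ k => exact measurable_pi_apply k

lemma code_consWord (i : Fin 4) (w : ℕ → Fin 4) : code (consWord i w) = T i (code w) := by
  apply Subtype.ext
  rw [T_coe]
  change codeAux (consWord i w) = (3 / 4 : ℝ) • corner i + (1 / 4 : ℝ) • codeAux w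
  rw [codeAux, (summable_code _).tsum_eq_zero_add, codeAux, ← tsum_const_smul'']
  congr 1
  · simp [consWord]
  · refine tsum_congr fun k => ?_
    rw [smul_smul]
    congr 1
    ring

/-- The uniform probability measure on four letters. -/
def unif4 : Measure (Fin 4) := uniformOn Set.univ

instance : IsProbabilityMeasure unif4 := by
  unfold unif4
  infer_instance

lemma unif4_apply (s : Set (Fin 4)) : unif4 s = ∑ i : Fin 4, (1 / 4 : ℝ≥0∞) * s.indicator 1 i := by
  classical
  have h : unif4 = ∑ i : Fin 4, (1 / 4 : ℝ≥0∞) • Measure.dirac i := by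
    refine Measure.ext_of_singleton fun a => ?_
    rw [unif4, uniformOn_univ]
    simp [Set.indicator_apply, eq_comm]
  rw [h]
  simp

/-- The law of an i.i.d. uniform address. -/
def wordMeasure : Measure (ℕ → Fin 4) := Measure.infinitePi fun _ => unif4

instance : IsProbabilityMeasure wordMeasure := by
  unfold wordMeasure
  infer_instance

lemma wordMeasure_eq :
    ∑ i : Fin 4, (1 / 4 : ℝ≥0∞) • wordMeasure.map (consWord i) = wordMeasure := by
  classical
  refine Measure.eq_infinitePi _ fun s t ht => ?_
  set s' : Finset ℕ := (s.erase 0).image Nat.pred with hs'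
  have hpre (i : Fin 4) : consWord i ⁻¹' (Set.pi s t) =
      if 0 ∈ s ∧ i ∉ t 0 then ∅ else Set.pi s' (fun k => t (k + 1)) := by
    ext w
    have h1 : w ∈ consWord i ⁻¹' (Set.pi s t) ↔
        (0 ∈ s → i ∈ t 0) ∧ ∀ k, k + 1 ∈ s → w k ∈ t (k + 1) := by
      constructor
      · exact fun h => ⟨fun h0 => h 0 h0, fun k hk => h (k + 1) hk⟩
      · rintro ⟨h0, h⟩ k hk
        cases k with
        | zero => exact h0 hk
        | succ k => exact h k hk
    have h2 : w ∈ Set.pi (s' : Set ℕ) (fun k => t (k + 1)) ↔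
        ∀ k, k + 1 ∈ s → w k ∈ t (k + 1) := by
      refine forall_congr' fun k => imp_congr_left ?_
      simp only [hs', Finset.coe_image, Set.mem_image, Finset.mem_coe, Finset.mem_erase]
      constructor
      · rintro ⟨m, ⟨hm0, hm⟩, rfl⟩
        rwa [Nat.pred_eq_sub_one, Nat.sub_add_cancel (Nat.pos_of_ne_zero hm0)]
      · exact fun h => ⟨k + 1, ⟨k.succ_ne_zero, h⟩, rfl⟩
    rw [h1]
    split_ifs with hc
    · simp only [Set.mem_empty_iff_false, iff_false]
      exact fun h => hc.2 (h.1 hc.1)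
    · rw [h2]
      push Not at hc
      exact ⟨fun h => h.2, fun h => ⟨hc, h⟩⟩
  have hprod : wordMeasure (Set.pi s' (fun k => t (k + 1))) =
      ∏ k ∈ s.erase 0, unif4 (t k) := by
    rw [wordMeasure, Measure.infinitePi_pi _ (fun k _ => ht _), hs', Finset.prod_image]
    · refine Finset.prod_congr rfl fun k hk => ?_
      rw [Nat.pred_eq_sub_one, Nat.sub_add_cancel (Nat.pos_of_ne_zero (Finset.ne_of_mem_erase hk))]
    · intro a ha b hb hab
      have ha' := Finset.ne_of_mem_erase ha
      have hb' := Finset.ne_of_mem_erase hb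
      simp only [Nat.pred_eq_sub_one] at hab
      omega
  have hmeas : MeasurableSet (Set.pi (s : Set ℕ) t) :=
    MeasurableSet.pi s.countable_toSet fun k _ => ht k
  simp only [Measure.coe_finsetSum, Measure.coe_smul, Finset.sum_apply, Pi.smul_apply,
    smul_eq_mul, Measure.map_apply (measurable_consWord _) hmeas, hpre]
  by_cases h0 : 0 ∈ s
  · rw [← Finset.mul_prod_erase s _ h0, ← hprod, unif4_apply, Finset.sum_mul]
    refine Finset.sum_congr rfl fun i _ => ?_
    by_cases hi : i ∈ t 0 <;> simp [h0, hi]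
  · rw [Finset.erase_eq_of_notMem h0] at hprod
    rw [← hprod]
    simp only [h0, false_and, if_false]
    rw [← Finset.sum_mul]
    have : ∑ _i : Fin 4, (1 / 4 : ℝ≥0∞) = 1 := by
      simp [ENNReal.mul_inv_cancel]
    rw [this, one_mul]

/-! ### Existence and uniqueness of the fixed probability measure -/

lemma exists_fixed : ∃ ν : Measure unitSquare, IsProbabilityMeasure ν ∧ transfer ν = ν := by
  refine ⟨wordMeasure.map code, Measure.isProbabilityMeasure_map measurable_code.aemeasurable, ?_⟩
  have h (i : Fin 4) : (wordMeasure.map code).map (T i) = (wordMeasure.map (consWord i)).map code := by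
    rw [Measure.map_map (measurable_T i) measurable_code,
      Measure.map_map measurable_code (measurable_consWord i)]
    congr 1
    funext w
    exact (code_consWord i w).symm
  conv_rhs => rw [← wordMeasure_eq]
  simp only [transfer, h]
  rw [← Measure.mapₗ_apply_of_measurable measurable_code, map_sum]
  simp only [Measure.map_smul, Measure.mapₗ_apply_of_measurable measurable_code]

/-- The characteristic function of a measure on the unit square. -/
def cf (ν : Measure unitSquare) (t : EuclideanSpace ℝ (Fin 2)) : ℂ :=
  charFun (ν.map (Subtype.val : unitSquare → EuclideanSpace ℝ (Fin 2))) t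

lemma cf_eq (ν : Measure unitSquare) (t : EuclideanSpace ℝ (Fin 2)) :
    cf ν t = ∫ x : unitSquare, Complex.exp (inner ℝ x.1 t * Complex.I) ∂ν := by
  rw [cf, charFun_apply, integral_map measurable_subtype_coe.aemeasurable]
  exact (by fun_prop : Continuous _).aestronglyMeasurable

lemma cf_transfer (ν : Measure unitSquare) [IsProbabilityMeasure ν]
    (t : EuclideanSpace ℝ (Fin 2)) :
    cf (transfer ν) t = ∑ i : Fin 4, (1 / 4 : ℂ) *
      (Complex.exp (inner ℝ ((3 / 4 : ℝ) • corner i) t * Complex.I) * cf ν ((1 / 4 : ℝ) • t)) := by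
  have hc : Continuous fun x : unitSquare => Complex.exp (inner ℝ x.1 t * Complex.I) := by fun_prop
  have hint (m : Measure unitSquare) [IsFiniteMeasure m] :
      Integrable (fun x : unitSquare => Complex.exp (inner ℝ x.1 t * Complex.I)) m :=
    Integrable.of_bound hc.aestronglyMeasurable 1 (Filter.Eventually.of_forall fun x => by
      rw [Complex.norm_exp_ofReal_mul_I])
  rw [cf_eq, transfer, integral_finsetSum_measure]
  · refine Finset.sum_congr rfl fun i _ => ?_
    rw [integral_smul_measure, integral_map (measurable_T i).aemeasurable
      hc.aestronglyMeasurable, cf_eq, ← integral_const_mul]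
    simp only [T_coe, inner_add_left, Complex.ofReal_add, add_mul, Complex.exp_add]
    rw [Complex.real_smul]
    congr 1
    · simp
    · refine integral_congr_ae (Filter.Eventually.of_forall fun x => ?_)
      simp [real_inner_smul_left, real_inner_smul_right]
  · intro i _
    exact (hint _).smul_measure (by simp)

lemma fixed_unique {μ ν : Measure unitSquare} [IsProbabilityMeasure μ] [IsProbabilityMeasure ν]
    (hμ : transfer μ = μ) (hν : transfer ν = ν) : μ = ν := by
  have step (t : EuclideanSpace ℝ (Fin 2)) :
      ‖cf μ t - cf ν t‖ ≤ ‖cf μ ((1 / 4 : ℝ) • t) - cf ν ((1 / 4 : ℝ) • t)‖ := by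
    have e : cf μ t - cf ν t = ∑ i : Fin 4, (1 / 4 : ℂ) *
        (Complex.exp (inner ℝ ((3 / 4 : ℝ) • corner i) t * Complex.I) *
          (cf μ ((1 / 4 : ℝ) • t) - cf ν ((1 / 4 : ℝ) • t))) := by
      conv_lhs => rw [← hμ, ← hν, cf_transfer, cf_transfer, ← Finset.sum_sub_distrib]
      exact Finset.sum_congr rfl fun i _ => by ring
    rw [e]
    refine (norm_sum_le _ _).trans ?_
    simp only [norm_mul, Complex.norm_exp_ofReal_mul_I, one_mul]
    rw [Finset.sum_const]
    simp
  have iter (t : EuclideanSpace ℝ (Fin 2)) (n : ℕ) :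
      ‖cf μ t - cf ν t‖ ≤ ‖cf μ (((1 / 4 : ℝ) ^ n) • t) - cf ν (((1 / 4 : ℝ) ^ n) • t)‖ := by
    induction n with
    | zero => simp
    | succ n ih =>
      refine ih.trans ((step _).trans (le_of_eq ?_))
      rw [smul_smul, ← pow_succ']
  have cont (m : Measure unitSquare) [IsProbabilityMeasure m] : Continuous (cf m) := by
    have : cf m = fun t => ∫ x : unitSquare, Complex.exp (inner ℝ x.1 t * Complex.I) ∂m :=
      funext (cf_eq m)
    rw [this]
    refine continuous_of_dominated (bound := fun _ => 1)
      (fun t => (by fun_prop : Continuous _).aestronglyMeasurable) (fun t => ?_)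
      (integrable_const _) (Filter.Eventually.of_forall fun x => by fun_prop)
    exact Filter.Eventually.of_forall fun x => by rw [Complex.norm_exp_ofReal_mul_I]
  have hcf (t : EuclideanSpace ℝ (Fin 2)) : cf μ t = cf ν t := by
    have h0 : Filter.Tendsto (fun n : ℕ => ((1 / 4 : ℝ) ^ n) • t) Filter.atTop (nhds 0) := by
      have := (tendsto_pow_atTop_nhds_zero_of_lt_one (r := (1 / 4 : ℝ)) (by norm_num)
        (by norm_num)).smul_const t
      simpa only [zero_smul] using this
    have hl := (((cont μ).sub (cont ν)).norm.tendsto 0).comp h0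
    have hz : ‖cf μ 0 - cf ν 0‖ = 0 := by simp [cf_eq]
    rw [Pi.sub_apply, hz] at hl
    have := ge_of_tendsto' hl (iter t)
    exact sub_eq_zero.1 (norm_le_zero_iff.1 this)
  have hs : MeasurableSet unitSquare := by
    have : unitSquare = ⋂ j, {x : EuclideanSpace ℝ (Fin 2) | x j ∈ Set.Icc (0 : ℝ) 1} := by
      ext x
      simp [unitSquare]
    rw [this]
    exact MeasurableSet.iInter fun j => (by fun_prop :
      Measurable fun x : EuclideanSpace ℝ (Fin 2) => x j) measurableSet_Icc
  have emb := MeasurableEmbedding.subtype_coe hs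
  have p1 := Measure.isProbabilityMeasure_map (μ := μ) emb.measurable.aemeasurable
  have p2 := Measure.isProbabilityMeasure_map (μ := ν) emb.measurable.aemeasurable
  have := Measure.ext_of_charFun (funext hcf)
  rw [← emb.comap_map μ, ← emb.comap_map ν, this]

/-- There is exactly one probability measure on the unit square that is fixed by `transfer`. -/
theorem existsUnique_fixed :
    ∃! ν : Measure unitSquare, IsProbabilityMeasure ν ∧ transfer ν = ν := by
  obtain ⟨ν, hν, h⟩ := exists_fixed
  exact ⟨ν, ⟨hν, h⟩, fun m hm => by
    have := hm.1
    exact fixed_unique hm.2 h⟩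

/-- The natural measure on the four-corner Cantor set: the unique probability measure on the
unit square that is a fixed point of `transfer`. -/
def cantorMeasure : Measure unitSquare := existsUnique_fixed.choose

instance : IsProbabilityMeasure cantorMeasure := existsUnique_fixed.choose_spec.1.1

theorem transfer_cantorMeasure : transfer cantorMeasure = cantorMeasure :=
  existsUnique_fixed.choose_spec.1.2

theorem eq_cantorMeasure {ν : Measure unitSquare} (h : IsProbabilityMeasure ν)
    (hν : transfer ν = ν) : ν = cantorMeasure :=
  existsUnique_fixed.choose_spec.2 ν ⟨h, hν⟩

/-! ### The Wasserstein distance and the empirical measure -/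

/-- The real functions `f` on the unit square with `|f x - f y| ≤ ‖x - y‖ ^ q` for all `x`, `y`,
where `‖·‖` is the Euclidean norm. -/
def Hol (q : ℝ) : Set (unitSquare → ℝ) :=
  {f | ∀ x y : unitSquare, |f x - f y| ≤ ‖(x : EuclideanSpace ℝ (Fin 2)) - y‖ ^ q}

/-- The `q`-Wasserstein distance of two measures on the unit square, in its dual form.
For `q ∈ (0, 1]` and probability measures, `f` is continuous and bounded up to a constant, so that
the integrals are defined and the supremum is that of a nonempty bounded set. -/
def W (q : ℝ) (μ ν : Measure unitSquare) : ℝ :=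
  ⨆ f : Hol q, |∫ x, f.1 x ∂μ - ∫ x, f.1 x ∂ν|

/-- The empirical measure of the points `x 1, …, x n`. -/
def empirical (n : ℕ) (x : ℕ → unitSquare) : Measure unitSquare :=
  (n : ℝ≥0∞)⁻¹ • ∑ k ∈ Finset.Icc 1 n, Measure.dirac (x k)

end FourCorners

end

/-! The four maps separate the square into cells at distance at least 1/2, so addressing points by
words in four letters turns the Cantor measure into the uniform product measure. If two words first
differ at letter `k`, the distance of their points is comparable to `4 ^ (-k)`, and its square root
to `2 ^ (-k)`. A Hölder function of exponent 1/2 is thus a function on a 4-ary tree whose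
oscillation on a cylinder of level `k` is of order `2 ^ (-k)`.

On such a tree the dual distance to the Cantor measure is comparable, up to truncation, to the sum
over `k` of `2 ^ (-k)` times `cylDev k`. The upper bound (`W_le_sum_cylDev`) telescopes a test
function over the levels. The lower bound (`sum_cylDev_le_W`) adds up the signs of all the cylinder
deviations with weights `2 ^ (-k)`; the tree structure makes this sum Hölder, and a McShane
extension carries it to the square.

For an i.i.d. sample, each of the `4 ^ k` cylinders deviates on average by about `2 ^ (-k) / √n` as
long as `4 ^ k` is at most of order `n` (`integral_cylDev_empirical`, from second and fourth
moments). Hence the mean of `cylDev k` is about `2 ^ k / √n`, and the weight `2 ^ (-k)` cancels the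
growth exactly: every scale contributes `1 / √n`. There are about `log n` scales before the
truncation error falls to `1 / √n`, whence `log n / √n`. -/

namespace FourCorners

/-! ### Addresses of points -/

/-- The index of the corner in the same quadrant of the unit square as `x`. -/
noncomputable def letter (x : EuclideanSpace ℝ (Fin 2)) : Fin 4 :=
  if x 0 < 1 / 2 then (if x 1 < 1 / 2 then 0 else 1) else (if x 1 < 1 / 2 then 3 else 2)

/-- The expanding map of the plane that inverts each homothety on its image. -/
noncomputable def expand (x : EuclideanSpace ℝ (Fin 2)) : EuclideanSpace ℝ (Fin 2) :=
  (4 : ℝ) • x - (3 : ℝ) • corner (letter x)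

/-- The address of a point: the letters of its orbit under `expand`. -/
noncomputable def address (x : unitSquare) (k : ℕ) : Fin 4 :=
  letter (expand^[k] (x : EuclideanSpace ℝ (Fin 2)))

lemma T_coe_apply (i : Fin 4) (x : unitSquare) (j : Fin 2) :
    (T i x : EuclideanSpace ℝ (Fin 2)) j = (3 / 4 : ℝ) * corner i j + (1 / 4 : ℝ) * x.1 j := by
  rw [T_coe]
  simp

/-- Each coordinate of a point in the image of `T i` lies in `[0, 1/4]` or `[3/4, 1]`, according to
the corner, so the quadrant reveals `i`. -/
lemma letter_T (i : Fin 4) (x : unitSquare) : letter (T i x).1 = i := by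
  have h0 := x.2 0
  have h1 := x.2 1
  rw [Set.mem_Icc] at h0 h1
  have e0 := T_coe_apply i x 0
  have e1 := T_coe_apply i x 1
  unfold letter
  rw [e0, e1]
  fin_cases i <;> simp only [corner] <;> simp <;> grind

lemma expand_T (i : Fin 4) (x : unitSquare) : expand (T i x).1 = x.1 := by
  rw [expand, letter_T, T_coe]
  module

lemma address_T_zero (i : Fin 4) (x : unitSquare) : address (T i x) 0 = i := letter_T i x

lemma address_T_succ (i : Fin 4) (x : unitSquare) (k : ℕ) :
    address (T i x) (k + 1) = address x k := by
  rw [address, Function.iterate_succ_apply, expand_T, address]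

lemma code_eq_T (w : ℕ → Fin 4) : code w = T (w 0) (code fun k => w (k + 1)) := by
  rw [← code_consWord]
  congr 1
  funext k
  cases k <;> rfl

/-- A measurable left inverse of `code`: it allows cylinders to be defined as measurable subsets of
the whole square, and events about points of the Cantor set to be read off words. -/
lemma address_code (w : ℕ → Fin 4) : address (code w) = w := by
  funext k
  induction k generalizing w with
  | zero => rw [code_eq_T, address_T_zero]
  | succ k ih => rw [code_eq_T, address_T_succ, ih]

lemma measurable_letter : Measurable letter := by
  have h (j : Fin 2) : MeasurableSet {x : EuclideanSpace ℝ (Fin 2) | x j < 1 / 2} :=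
    measurableSet_lt (by fun_prop) measurable_const
  exact Measurable.ite (h 0) (Measurable.ite (h 1) measurable_const measurable_const)
    (Measurable.ite (h 1) measurable_const measurable_const)

lemma measurable_expand : Measurable expand :=
  (measurable_id.const_smul (4 : ℝ)).sub
    (((measurable_of_countable corner).comp measurable_letter).const_smul (3 : ℝ))

lemma measurable_address : Measurable address :=
  measurable_pi_lambda _ fun k =>
    measurable_letter.comp ((measurable_expand.iterate k).comp measurable_subtype_coe)

/-! ### The measure in terms of addresses -/

lemma cantorMeasure_eq_map_code : cantorMeasure = wordMeasure.map code := by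
  symm
  refine eq_cantorMeasure (Measure.isProbabilityMeasure_map measurable_code.aemeasurable) ?_
  have h (i : Fin 4) :
      (wordMeasure.map code).map (T i) = (wordMeasure.map (consWord i)).map code := by
    rw [Measure.map_map (measurable_T i) measurable_code,
      Measure.map_map measurable_code (measurable_consWord i)]
    congr 1
    funext w
    exact (code_consWord i w).symm
  conv_rhs => rw [← wordMeasure_eq]
  simp only [transfer, h]
  rw [← Measure.mapₗ_apply_of_measurable measurable_code, map_sum]
  simp only [Measure.map_smul, Measure.mapₗ_apply_of_measurable measurable_code]

lemma measurableSet_code_address : MeasurableSet {x | code (address x) = x} :=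
  measurableSet_eq_fun (measurable_code.comp measurable_address) measurable_id

/-- Almost every point is the point of its own address. This stands in for membership in the Cantor
set, and is measurable because both maps are. -/
lemma ae_code_address : ∀ᵐ x ∂cantorMeasure, code (address x) = x := by
  rw [cantorMeasure_eq_map_code, ae_map_iff measurable_code.aemeasurable measurableSet_code_address]
  exact Filter.Eventually.of_forall fun w => by rw [address_code]

/-- The first `k` letters of the address of a point. -/
noncomputable def addrPrefix (k : ℕ) (x : unitSquare) : Fin k → Fin 4 := fun j => address x j

lemma measurable_addrPrefix (k : ℕ) : Measurable (addrPrefix k) :=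
  measurable_pi_lambda _ fun j => (measurable_pi_apply (j : ℕ)).comp measurable_address

lemma unif4_singleton (a : Fin 4) : unif4 {a} = 1 / 4 := by
  rw [unif4_apply]
  simp [Set.indicator_apply]

lemma cantorMeasure_addrPrefix (k : ℕ) (u : Fin k → Fin 4) :
    cantorMeasure.real (addrPrefix k ⁻¹' {u}) = (1 / 4 : ℝ) ^ k := by
  have hm := measurable_addrPrefix k (measurableSet_singleton u)
  have e : code ⁻¹' (addrPrefix k ⁻¹' {u}) = Set.pi (Finset.range k : Set ℕ)
      (fun j => if h : j < k then {u ⟨j, h⟩} else Set.univ) := by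
    ext w
    simp only [Set.mem_preimage, Set.mem_singleton_iff, Set.mem_pi, Finset.coe_range, Set.mem_Iio,
      addrPrefix, address_code, funext_iff]
    constructor
    · intro h j hj
      simpa [hj] using h ⟨j, hj⟩
    · intro h j
      simpa using h j j.2
  rw [measureReal_def, cantorMeasure_eq_map_code, Measure.map_apply measurable_code hm, e,
    wordMeasure, Measure.infinitePi_pi]
  · rw [Finset.prod_congr rfl (g := fun _ => (1 / 4 : ℝ≥0∞))]
    · simp
    · intro j hj
      rw [dif_pos (Finset.mem_range.1 hj), unif4_singleton]
  · intro j _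
    split_ifs <;> measurability

/-! ### Distances -/

lemma dist_T (i : Fin 4) (x y : unitSquare) : dist (T i x) (T i y) = 1 / 4 * dist x y := by
  rw [Subtype.dist_eq, Subtype.dist_eq, T_coe, T_coe, dist_add_left, dist_smul₀]
  norm_num

lemma dist_le_two (x y : unitSquare) : dist x y ≤ 2 := by
  rw [Subtype.dist_eq, EuclideanSpace.dist_eq, Real.sqrt_le_left (by norm_num), Fin.sum_univ_two]
  have h (j : Fin 2) : dist (x.1 j) (y.1 j) ^ 2 ≤ 1 := by
    rw [Real.dist_eq, sq_abs]
    have h1 := x.2 j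
    have h2 := y.2 j
    rw [Set.mem_Icc] at h1 h2
    nlinarith
  linarith [h 0, h 1]

/-- Distinct corners differ by 1 in some coordinate, where the two images lie in `[0, 1/4]` and
`[3/4, 1]`. -/
lemma half_le_dist_T {i i' : Fin 4} (hi : i ≠ i') (x y : unitSquare) :
    1 / 2 ≤ dist (T i x) (T i' y) := by
  have hj : ∃ j, 1 ≤ |corner i j - corner i' j| := by
    revert hi
    fin_cases i <;> fin_cases i' <;> simp [corner, Fin.exists_fin_two]
  obtain ⟨j, hj⟩ := hj
  have h1 := x.2 j
  have h2 := y.2 j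
  rw [Set.mem_Icc] at h1 h2
  have h3 : |(T i x).1 j - (T i' y).1 j| ≤ dist (T i x) (T i' y) := by
    rw [Subtype.dist_eq, dist_eq_norm]
    exact PiLp.norm_apply_le ((T i x).1 - (T i' y).1) j
  refine le_trans ?_ h3
  rw [T_coe_apply, T_coe_apply]
  rcases le_abs.1 hj with h | h
  · exact le_abs.2 (Or.inl (by linarith))
  · exact le_abs.2 (Or.inr (by linarith))

lemma dist_code_le {w w' : ℕ → Fin 4} {k : ℕ} (h : ∀ j < k, w j = w' j) :
    dist (code w) (code w') ≤ 2 * (1 / 4) ^ k := by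
  induction k generalizing w w' with
  | zero => simpa using dist_le_two _ _
  | succ k ih =>
    rw [code_eq_T w, code_eq_T w', ← h 0 k.succ_pos, dist_T]
    have := ih (w := fun k => w (k + 1)) (w' := fun k => w' (k + 1))
      fun j hj => h (j + 1) (by omega)
    rw [pow_succ]
    linarith

/-- With `dist_code_le`, this makes the distance of two points comparable to `4 ^ (-k)` for `k` the
first index where their addresses differ: the common prefix contracts by exactly `1/4` per letter,
and the next letter separates. -/
lemma le_dist_code {w w' : ℕ → Fin 4} {k : ℕ} (h : ∀ j < k, w j = w' j) (hk : w k ≠ w' k) :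
    1 / 2 * (1 / 4) ^ k ≤ dist (code w) (code w') := by
  induction k generalizing w w' with
  | zero =>
    rw [code_eq_T w, code_eq_T w']
    simpa using half_le_dist_T hk _ _
  | succ k ih =>
    rw [code_eq_T w, code_eq_T w', ← h 0 k.succ_pos, dist_T]
    have := ih (w := fun k => w (k + 1)) (w' := fun k => w' (k + 1))
      (fun j hj => h (j + 1) (by omega)) hk
    rw [pow_succ]
    linarith

end FourCorners

/-! ### Moments of sums of independent bounded centred variables -/

section Moments

variable {Ω : Type*} [MeasurableSpace Ω] {P : Measure Ω}

lemma integrable_pow_of_abs_le [IsFiniteMeasure P] {f : Ω → ℝ} (hf : AEMeasurable f P) {B : ℝ}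
    (hB : ∀ ω, |f ω| ≤ B) (k : ℕ) : Integrable (fun ω => f ω ^ k) P :=
  Integrable.of_bound (hf.pow_const k).aestronglyMeasurable (B ^ k)
    (Filter.Eventually.of_forall fun ω => by
      rw [norm_pow, Real.norm_eq_abs]
      exact pow_le_pow_left₀ (abs_nonneg _) (hB ω) k)

lemma ProbabilityTheory.IndepFun.integral_pow_mul_pow {f g : Ω → ℝ} (h : IndepFun f g P)
    (hf : AEMeasurable f P) (hg : AEMeasurable g P) (a b : ℕ) :
    ∫ ω, f ω ^ a * g ω ^ b ∂P = (∫ ω, f ω ^ a ∂P) * ∫ ω, g ω ^ b ∂P :=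
  h.integral_fun_comp_mul_comp (f := fun x => x ^ a) (g := fun x => x ^ b) hf hg
    (by fun_prop) (by fun_prop)

/-- The first, second and fourth moments of a sum of independent centred variables bounded by `1`
with variance `v`. -/
lemma moments_sum [IsProbabilityMeasure P] {ι : Type*} {Z : ι → Ω → ℝ}
    (hm : ∀ i, AEMeasurable (Z i) P) (hind : iIndepFun Z P) (hb : ∀ i ω, |Z i ω| ≤ 1) {v : ℝ}
    (h1 : ∀ i, ∫ ω, Z i ω ∂P = 0) (h2 : ∀ i, ∫ ω, Z i ω ^ 2 ∂P = v) (s : Finset ι) :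
    ∫ ω, (∑ i ∈ s, Z i ω) ∂P = 0 ∧ ∫ ω, (∑ i ∈ s, Z i ω) ^ 2 ∂P = s.card * v ∧
      ∫ ω, (∑ i ∈ s, Z i ω) ^ 4 ∂P ≤ s.card * v + 3 * (s.card * v) ^ 2 := by
  classical
  induction s using Finset.induction_on with
  | empty => simp
  | insert i s hi ih =>
    obtain ⟨e1, e2, e4⟩ := ih
    set S : Ω → ℝ := fun ω => ∑ j ∈ s, Z j ω with hS
    have hSm : AEMeasurable S P := Finset.aemeasurable_fun_sum s fun j _ => hm j
    have hSb (ω : Ω) : |S ω| ≤ s.card := by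
      refine (Finset.abs_sum_le_sum_abs _ _).trans ((Finset.sum_le_sum fun j _ => hb j ω).trans ?_)
      simp
    have hSZ : IndepFun S (Z i) P := by
      have := hind.indepFun_finsetSum_of_notMem₀ hm hi
      rwa [show ∑ j ∈ s, Z j = S by funext ω; simp [hS]] at this
    have hi2 (a b : ℕ) : Integrable (fun ω => S ω ^ a * Z i ω ^ b) P :=
      (integrable_pow_of_abs_le hSm hSb a).mul_bdd (c := 1)
        ((hm i).pow_const b).aestronglyMeasurable (Filter.Eventually.of_forall fun ω => by
          rw [norm_pow, Real.norm_eq_abs]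
          exact pow_le_one₀ (abs_nonneg _) (hb i ω))
    have hmul (a b : ℕ) := hSZ.integral_pow_mul_pow hSm (hm i) a b
    have hp (k : ℕ) : Integrable (fun ω => S ω ^ k) P := integrable_pow_of_abs_le hSm hSb k
    have hz (k : ℕ) : Integrable (fun ω => Z i ω ^ k) P := integrable_pow_of_abs_le (hm i) (hb i) k
    have hv : 0 ≤ v := by
      rw [← h2 i]
      exact integral_nonneg fun ω => sq_nonneg _
    have hz4 : ∫ ω, Z i ω ^ 4 ∂P ≤ v := by
      rw [← h2 i]
      refine integral_mono (hz 4) (hz 2) fun ω => ?_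
      have h0 : Z i ω ^ 2 ≤ 1 := by
        rw [← sq_abs]
        exact pow_le_one₀ (abs_nonneg _) (hb i ω)
      change Z i ω ^ 4 ≤ Z i ω ^ 2
      nlinarith [sq_nonneg (Z i ω)]
    simp only [Finset.sum_insert hi, Finset.card_insert_of_notMem hi]
    have es (ω : Ω) : ∑ j ∈ s, Z j ω = S ω := rfl
    simp only [es] at e1 e2 e4 ⊢
    refine ⟨?_, ?_, ?_⟩
    · rw [integral_add (by simpa using hz 1) (by simpa using hp 1), e1, h1, add_zero]
    · have e (ω : Ω) : (Z i ω + S ω) ^ 2 = Z i ω ^ 2 + 2 * (S ω ^ 1 * Z i ω ^ 1) + S ω ^ 2 := by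
        ring
      simp only [e]
      rw [integral_add ((hz 2).fun_add ((hi2 1 1).const_mul 2)) (hp 2),
        integral_add (hz 2) ((hi2 1 1).const_mul 2), integral_const_mul, hmul, h2, e2]
      simp only [pow_one, e1]
      push_cast
      ring
    · have e (ω : Ω) : (Z i ω + S ω) ^ 4 = Z i ω ^ 4 + 4 * (S ω ^ 1 * Z i ω ^ 3)
          + 6 * (S ω ^ 2 * Z i ω ^ 2) + 4 * (S ω ^ 3 * Z i ω ^ 1) + S ω ^ 4 := by
        ring
      simp only [e]
      rw [integral_add ((((hz 4).fun_add ((hi2 1 3).const_mul 4)).fun_add ((hi2 2 2).const_mul 6)).fun_add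
          ((hi2 3 1).const_mul 4)) (hp 4),
        integral_add (((hz 4).fun_add ((hi2 1 3).const_mul 4)).fun_add ((hi2 2 2).const_mul 6))
          ((hi2 3 1).const_mul 4),
        integral_add ((hz 4).fun_add ((hi2 1 3).const_mul 4)) ((hi2 2 2).const_mul 6),
        integral_add (hz 4) ((hi2 1 3).const_mul 4), integral_const_mul, integral_const_mul,
        integral_const_mul, hmul, hmul, hmul, h2, e2]
      simp only [pow_one, e1, h1]
      push_cast
      -- After the odd cross terms vanish, the claimed bound exceeds `v + 6 * s.card * v ^ 2` plus
      -- the bound for `s` by exactly `3 * v ^ 2`.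
      nlinarith [sq_nonneg v]

/-- The mean absolute value of a variable is at most the root of its second moment. -/
lemma integral_abs_le_sqrt [IsProbabilityMeasure P] {f : Ω → ℝ} (hf : AEMeasurable f P) {B : ℝ}
    (hB : ∀ ω, |f ω| ≤ B) : ∫ ω, |f ω| ∂P ≤ √(∫ ω, f ω ^ 2 ∂P) := by
  refine Real.le_sqrt_of_sq_le ?_
  have hi : Integrable (fun ω => |f ω|) P := by
    simpa using (integrable_pow_of_abs_le hf hB 1).abs
  set m := ∫ ω, |f ω| ∂P
  have h : 0 ≤ ∫ ω, (|f ω| - m) ^ 2 ∂P := integral_nonneg fun ω => sq_nonneg _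
  have e (ω : Ω) : (|f ω| - m) ^ 2 = f ω ^ 2 + -2 * m * |f ω| + m ^ 2 := by
    rw [sub_sq, sq_abs]
    ring
  simp only [e] at h
  rw [integral_add ((integrable_pow_of_abs_le hf hB 2).fun_add (hi.const_mul _))
      (integrable_const _), integral_add (integrable_pow_of_abs_le hf hB 2) (hi.const_mul _),
    integral_const_mul, integral_const] at h
  simp only [probReal_univ, one_smul] at h
  change 0 ≤ _ + -2 * m * m + m ^ 2 at h
  linarith

/-- This is `u ^ 2 - u ^ 4 ≤ u` for `u = |s| / t`, multiplied by `t`. Integrated, it bounds a first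
moment below by second and fourth moments, with `t` free to be optimised. -/
lemma sq_div_sub_le_abs (s : ℝ) {t : ℝ} (ht : 0 < t) : s ^ 2 / t - s ^ 4 / t ^ 3 ≤ |s| := by
  have h : |s| / t * (|s| / t) - (|s| / t) ^ 4 ≤ |s| / t := by
    have hu : 0 ≤ |s| / t := by positivity
    set u := |s| / t
    rcases le_total u 1 with h | h
    · nlinarith [pow_nonneg hu 4]
    · have : u * u ≤ u ^ 4 := by
        rw [← pow_two]
        exact pow_le_pow_right₀ h (by norm_num)
      linarith
  have h2 := mul_le_mul_of_nonneg_left h ht.le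
  have e1 : t * (|s| / t) = |s| := by field_simp
  have e2 : t * (|s| / t * (|s| / t) - (|s| / t) ^ 4) = s ^ 2 / t - s ^ 4 / t ^ 3 := by
    rw [← sq_abs s, show s ^ 4 = |s| ^ 4 by rw [Even.pow_abs (by decide)]]
    field_simp
  rwa [e1, e2] at h2

/-- A lower bound for the mean absolute value in terms of the second and fourth moments. -/
lemma le_integral_abs [IsProbabilityMeasure P] {f : Ω → ℝ} (hf : AEMeasurable f P) {B : ℝ}
    (hB : ∀ ω, |f ω| ≤ B) {t : ℝ} (ht : 0 < t) :
    (∫ ω, f ω ^ 2 ∂P) / t - (∫ ω, f ω ^ 4 ∂P) / t ^ 3 ≤ ∫ ω, |f ω| ∂P := by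
  have hp := integrable_pow_of_abs_le hf hB
  rw [← integral_div, ← integral_div, ← integral_sub ((hp 2).div_const _) ((hp 4).div_const _)]
  exact integral_mono (((hp 2).div_const _).sub ((hp 4).div_const _))
    (by simpa using (hp 1).abs) fun ω => sq_div_sub_le_abs _ ht

/-- The mean absolute deviation of a sum of independent centred variables bounded by `1` with
variance `v` is of the order of its standard deviation, if the latter is bounded below. -/
lemma integral_abs_sum_bounds [IsProbabilityMeasure P] {ι : Type*} {Z : ι → Ω → ℝ}
    (hm : ∀ i, AEMeasurable (Z i) P) (hind : iIndepFun Z P) (hb : ∀ i ω, |Z i ω| ≤ 1) {v : ℝ}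
    (h1 : ∀ i, ∫ ω, Z i ω ∂P = 0) (h2 : ∀ i, ∫ ω, Z i ω ^ 2 ∂P = v) (s : Finset ι) :
    ∫ ω, |∑ i ∈ s, Z i ω| ∂P ≤ √(s.card * v) ∧
      (1 / 6 ≤ s.card * v → √(s.card * v) / 10 ≤ ∫ ω, |∑ i ∈ s, Z i ω| ∂P) := by
  obtain ⟨-, e2, e4⟩ := moments_sum hm hind hb h1 h2 s
  have hSm : AEMeasurable (fun ω => ∑ i ∈ s, Z i ω) P := Finset.aemeasurable_fun_sum s fun j _ => hm j
  have hSb (ω : Ω) : |∑ i ∈ s, Z i ω| ≤ s.card := by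
    refine (Finset.abs_sum_le_sum_abs _ _).trans ((Finset.sum_le_sum fun j _ => hb j ω).trans ?_)
    simp
  refine ⟨?_, fun hv => ?_⟩
  · rw [← e2]
    exact integral_abs_le_sqrt hSm hSb
  · set V := (s.card : ℝ) * v
    have hV : 0 < V := by linarith
    have hσ := Real.sqrt_pos.2 hV
    have hσ2 := Real.sq_sqrt hV.le
    -- The scale `t = 4 * √V` leaves the factor `1/4 - 9/64 = 7/64`, which is more than `1/10`.
    refine le_trans ?_ (le_integral_abs hSm hSb (t := 4 * √V) (by positivity))
    rw [e2]
    -- Since `1/6 ≤ V`, the linear term satisfies `V ≤ 6 * V ^ 2`, so the fourth moment is at most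
    -- `9 * V ^ 2`.
    have h4 : (∫ ω, (∑ i ∈ s, Z i ω) ^ 4 ∂P) / (4 * √V) ^ 3 ≤ 9 * V ^ 2 / (4 * √V) ^ 3 := by
      gcongr
      nlinarith
    refine le_trans ?_ (sub_le_sub_left h4 _)
    set σ := √V
    rw [← hσ2]
    have : σ ^ 2 / (4 * σ) - 9 * (σ ^ 2) ^ 2 / (4 * σ) ^ 3 = 7 / 64 * σ := by
      field_simp
      ring
    rw [this]
    linarith

end Moments

namespace FourCorners

/-! ### Hölder functions of exponent one half -/

lemma mem_Hol_half {f : unitSquare → ℝ} :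
    f ∈ Hol (1 / 2) ↔ ∀ x y, |f x - f y| ≤ √(dist x y) := by
  simp only [Hol, Set.mem_ofPred_eq, Subtype.dist_eq, dist_eq_norm, Real.sqrt_eq_rpow]

lemma sqrt_dist_le_two (x y : unitSquare) : √(dist x y) ≤ 2 := by
  rw [Real.sqrt_le_left (by norm_num)]
  linarith [dist_le_two x y]

/-- The square root of the distance is again subadditive, so `Hol (1 / 2)` consists of the
1-Lipschitz functions for this metric and the McShane construction applies. -/
lemma sqrt_dist_triangle (x y z : unitSquare) : √(dist x z) ≤ √(dist x y) + √(dist y z) := by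
  refine (Real.sqrt_le_sqrt (dist_triangle x y z)).trans ?_
  rw [Real.sqrt_le_left (by positivity), add_sq, Real.sq_sqrt dist_nonneg,
    Real.sq_sqrt dist_nonneg]
  linarith [mul_nonneg (Real.sqrt_nonneg (dist x y)) (Real.sqrt_nonneg (dist y z))]

lemma continuous_of_mem_Hol {f : unitSquare → ℝ} (hf : f ∈ Hol (1 / 2)) : Continuous f := by
  rw [mem_Hol_half] at hf
  rw [continuous_iff_continuousAt]
  intro y
  rw [ContinuousAt, tendsto_iff_dist_tendsto_zero]
  have hc : Continuous fun x : unitSquare => √(dist x y) := by fun_prop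
  have := hc.tendsto y
  simp only [dist_self, Real.sqrt_zero] at this
  exact squeeze_zero (fun x => dist_nonneg) (fun x => by rw [Real.dist_eq]; exact hf x y) this

lemma integrable_of_mem_Hol {f : unitSquare → ℝ} (hf : f ∈ Hol (1 / 2)) (ν : Measure unitSquare)
    [IsFiniteMeasure ν] : Integrable f ν := by
  have x₀ : unitSquare := code fun _ => 0
  refine Integrable.of_bound (continuous_of_mem_Hol hf).aestronglyMeasurable (|f x₀| + 2)
    (Filter.Eventually.of_forall fun x => ?_)
  have h1 := mem_Hol_half.1 hf x x₀
  have h2 := abs_sub_abs_le_abs_sub (f x) (f x₀)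
  rw [Real.norm_eq_abs]
  linarith [sqrt_dist_le_two x x₀]

lemma abs_integral_sub_le_two {f : unitSquare → ℝ} (hf : f ∈ Hol (1 / 2)) (x₀ : unitSquare)
    (ν : Measure unitSquare) [IsProbabilityMeasure ν] : |∫ x, f x ∂ν - f x₀| ≤ 2 := by
  have e : ∫ x, f x ∂ν - f x₀ = ∫ x, (f x - f x₀) ∂ν := by
    rw [integral_sub (integrable_of_mem_Hol hf ν) (integrable_const _)]
    simp
  rw [e, ← Real.norm_eq_abs]
  refine (norm_integral_le_of_norm_le_const (C := 2) (Filter.Eventually.of_forall fun x => ?_)).trans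
    (by simp)
  exact (mem_Hol_half.1 hf x x₀).trans (sqrt_dist_le_two x x₀)

lemma abs_integral_sub_integral_le {f : unitSquare → ℝ} (hf : f ∈ Hol (1 / 2))
    (μ ν : Measure unitSquare) [IsProbabilityMeasure μ] [IsProbabilityMeasure ν] :
    |∫ x, f x ∂μ - ∫ x, f x ∂ν| ≤ 4 := by
  have x₀ : unitSquare := code fun _ => 0
  have h1 := abs_integral_sub_le_two hf x₀ μ
  have h2 := abs_integral_sub_le_two hf x₀ ν
  rw [abs_le] at *
  constructor <;> linarith [h1.1, h1.2, h2.1, h2.2]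

lemma bddAbove_Hol (μ ν : Measure unitSquare) [IsProbabilityMeasure μ] [IsProbabilityMeasure ν] :
    BddAbove (Set.range fun f : Hol (1 / 2) => |∫ x, f.1 x ∂μ - ∫ x, f.1 x ∂ν|) := by
  refine ⟨4, ?_⟩
  rintro _ ⟨f, rfl⟩
  exact abs_integral_sub_integral_le f.2 μ ν

lemma le_W {f : unitSquare → ℝ} (hf : f ∈ Hol (1 / 2)) (μ ν : Measure unitSquare)
    [IsProbabilityMeasure μ] [IsProbabilityMeasure ν] :
    |∫ x, f x ∂μ - ∫ x, f x ∂ν| ≤ W (1 / 2) μ ν :=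
  le_ciSup (bddAbove_Hol μ ν) ⟨f, hf⟩

lemma W_le {μ ν : Measure unitSquare} {B : ℝ}
    (h : ∀ f ∈ Hol (1 / 2), |∫ x, f x ∂μ - ∫ x, f x ∂ν| ≤ B) : W (1 / 2) μ ν ≤ B := by
  have : Nonempty (Hol (1 / 2)) := ⟨⟨fun _ => 0, mem_Hol_half.2 fun x y => by simp⟩⟩
  exact ciSup_le fun f => h f.1 f.2

lemma W_nonneg (q : ℝ) (μ ν : Measure unitSquare) : 0 ≤ W q μ ν :=
  Real.iSup_nonneg fun _ => abs_nonneg _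

/-- McShane extension for functions of Hölder exponent one half. -/
lemma exists_mem_Hol_extension {ι : Type*} [Nonempty ι] (p : ι → unitSquare) (g : ι → ℝ)
    (hg : ∀ i j, g i - g j ≤ √(dist (p i) (p j))) : ∃ f ∈ Hol (1 / 2), ∀ i, f (p i) = g i := by
  have hbdd (x : unitSquare) : BddBelow (Set.range fun i => g i + √(dist x (p i))) := by
    obtain ⟨i₀⟩ := (inferInstance : Nonempty ι)
    refine ⟨g i₀ - 2, ?_⟩
    rintro _ ⟨i, rfl⟩
    change g i₀ - 2 ≤ g i + √(dist x (p i))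
    linarith [hg i₀ i, sqrt_dist_le_two (p i₀) (p i), Real.sqrt_nonneg (dist x (p i))]
  have hle (x y : unitSquare) :
      ⨅ i, (g i + √(dist x (p i))) ≤ (⨅ i, (g i + √(dist y (p i)))) + √(dist x y) := by
    rw [← sub_le_iff_le_add]
    refine le_ciInf fun i => ?_
    linarith [ciInf_le (hbdd x) i, sqrt_dist_triangle x y (p i)]
  refine ⟨fun x => ⨅ i, (g i + √(dist x (p i))), mem_Hol_half.2 fun x y => ?_, fun i => ?_⟩
  · rw [abs_sub_le_iff]
    have h1 := hle x y
    have h2 := hle y x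
    rw [dist_comm y x] at h2
    constructor <;> linarith
  · refine le_antisymm ((ciInf_le (hbdd _) i).trans (by simp)) (le_ciInf fun j => ?_)
    linarith [hg i j]

/-! ### Comparison of the Wasserstein distance with deviations on cylinders -/

/-- The sum over the cylinders of level `k` of the deviations of `ν` from `4 ^ (-k)`. -/
noncomputable def cylDev (k : ℕ) (ν : Measure unitSquare) : ℝ :=
  ∑ u : Fin k → Fin 4, |ν.real (addrPrefix k ⁻¹' {u}) - (1 / 4) ^ k|

lemma integrable_comp_addrPrefix {k : ℕ} (h : (Fin k → Fin 4) → ℝ) (ν : Measure unitSquare)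
    [IsFiniteMeasure ν] : Integrable (fun x => h (addrPrefix k x)) ν :=
  Integrable.comp_measurable (Integrable.of_finite (f := h)) (measurable_addrPrefix k)

lemma integral_comp_addrPrefix {k : ℕ} (h : (Fin k → Fin 4) → ℝ) (ν : Measure unitSquare)
    [IsFiniteMeasure ν] :
    ∫ x, h (addrPrefix k x) ∂ν = ∑ u, ν.real (addrPrefix k ⁻¹' {u}) * h u := by
  rw [← integral_map (μ := ν) (f := h) (measurable_addrPrefix k).aemeasurable
    (measurable_of_countable h).aestronglyMeasurable, integral_fintype Integrable.of_finite]
  refine Finset.sum_congr rfl fun u _ => ?_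
  rw [map_measureReal_apply (measurable_addrPrefix k) (measurableSet_singleton u), smul_eq_mul]

lemma integral_comp_addrPrefix_sub {k : ℕ} (h : (Fin k → Fin 4) → ℝ) (ν : Measure unitSquare)
    [IsFiniteMeasure ν] :
    ∫ x, h (addrPrefix k x) ∂ν - ∫ x, h (addrPrefix k x) ∂cantorMeasure =
      ∑ u, (ν.real (addrPrefix k ⁻¹' {u}) - (1 / 4) ^ k) * h u := by
  rw [integral_comp_addrPrefix, integral_comp_addrPrefix, ← Finset.sum_sub_distrib]
  simp only [cantorMeasure_addrPrefix, sub_mul]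

lemma abs_integral_comp_addrPrefix_sub_le {k : ℕ} {h : (Fin k → Fin 4) → ℝ} {B : ℝ}
    (hB : ∀ u, |h u| ≤ B) (ν : Measure unitSquare) [IsFiniteMeasure ν] :
    |∫ x, h (addrPrefix k x) ∂ν - ∫ x, h (addrPrefix k x) ∂cantorMeasure| ≤ B * cylDev k ν := by
  rw [integral_comp_addrPrefix_sub, cylDev, Finset.mul_sum]
  refine (Finset.abs_sum_le_sum_abs _ _).trans (Finset.sum_le_sum fun u _ => ?_)
  rw [abs_mul, mul_comm]
  exact mul_le_mul_of_nonneg_right (hB u) (abs_nonneg _)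

/-- Extension of a finite word by zeros. -/
def padZero {k : ℕ} (u : Fin k → Fin 4) (j : ℕ) : Fin 4 := if h : j < k then u ⟨j, h⟩ else 0

lemma sqrt_quarter_pow (k : ℕ) : √((1 / 4 : ℝ) ^ k) = (1 / 2) ^ k := by
  rw [show (1 / 4 : ℝ) ^ k = ((1 / 2) ^ k) ^ 2 by rw [← pow_mul, mul_comm, pow_mul]; norm_num]
  exact Real.sqrt_sq (by positivity)

lemma abs_sub_le_of_mem_Hol {f : unitSquare → ℝ} (hf : f ∈ Hol (1 / 2)) {w w' : ℕ → Fin 4} {k : ℕ}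
    (h : ∀ j < k, w j = w' j) : |f (code w) - f (code w')| ≤ 2 * (1 / 2) ^ k := by
  refine (mem_Hol_half.1 hf _ _).trans ?_
  rw [← sqrt_quarter_pow, show (2 : ℝ) = √4 by
    rw [show (4 : ℝ) = 2 ^ 2 by norm_num]; exact (Real.sqrt_sq (by norm_num)).symm,
    ← Real.sqrt_mul (by norm_num)]
  refine Real.sqrt_le_sqrt ((dist_code_le h).trans ?_)
  have : (0 : ℝ) < (1 / 4) ^ k := by positivity
  linarith

/-- A test function is replaced by its value at the point of the address truncated to `m` letters
and padded by zeros. The passage from `k` to `k + 1` letters depends on `k + 1` letters only and is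
at most `2 * (1 / 2) ^ k`, so its integrals differ by at most that multiple of `cylDev (k + 1)`. The
truncation costs `2 * (1 / 2) ^ m` for each of the two measures. -/
lemma W_le_sum_cylDev (ν : Measure unitSquare) [IsProbabilityMeasure ν]
    (hν : ∀ᵐ x ∂ν, code (address x) = x) (m : ℕ) :
    W (1 / 2) ν cantorMeasure ≤
      ∑ k ∈ Finset.range m, 2 * (1 / 2) ^ k * cylDev (k + 1) ν + 4 * (1 / 2) ^ m := by
  refine W_le fun f hf => ?_
  set h : (k : ℕ) → (Fin k → Fin 4) → ℝ := fun k u => f (code (padZero u)) with hh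
  have key : |∫ x, h m (addrPrefix m x) ∂ν - ∫ x, h m (addrPrefix m x) ∂cantorMeasure| ≤
      ∑ k ∈ Finset.range m, 2 * (1 / 2) ^ k * cylDev (k + 1) ν := by
    induction m with
    | zero =>
      have e (x : unitSquare) : addrPrefix 0 x = Fin.elim0 := Subsingleton.elim _ _
      simp [e]
    | succ m ih =>
      rw [Finset.sum_range_succ]
      set H : (Fin (m + 1) → Fin 4) → ℝ := fun u => h (m + 1) u - h m fun j => u j.castSucc
      have hH (u : Fin (m + 1) → Fin 4) : |H u| ≤ 2 * (1 / 2) ^ m := by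
        refine abs_sub_le_of_mem_Hol hf fun j hj => ?_
        simp [padZero, hj, hj.trans m.lt_succ_self]
      have h1 := abs_integral_comp_addrPrefix_sub_le hH ν
      have e (ρ : Measure unitSquare) [IsProbabilityMeasure ρ] : ∫ x, H (addrPrefix (m + 1) x) ∂ρ =
          ∫ x, h (m + 1) (addrPrefix (m + 1) x) ∂ρ - ∫ x, h m (addrPrefix m x) ∂ρ :=
        integral_sub (integrable_comp_addrPrefix _ ρ) (integrable_comp_addrPrefix _ ρ)
      rw [e, e] at h1
      rw [abs_le] at *
      constructor <;> linarith [h1.1, h1.2, ih.1, ih.2]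
  have approx (ρ : Measure unitSquare) [IsProbabilityMeasure ρ]
      (hρ : ∀ᵐ x ∂ρ, code (address x) = x) :
      |∫ x, f x ∂ρ - ∫ x, h m (addrPrefix m x) ∂ρ| ≤ 2 * (1 / 2) ^ m := by
    rw [← integral_sub (integrable_of_mem_Hol hf ρ) (integrable_comp_addrPrefix _ ρ),
      ← Real.norm_eq_abs]
    refine (norm_integral_le_of_norm_le_const (C := 2 * (1 / 2) ^ m) ?_).trans (by simp)
    filter_upwards [hρ] with x hx
    rw [Real.norm_eq_abs]
    nth_rw 1 [← hx]
    refine abs_sub_le_of_mem_Hol hf fun j hj => ?_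
    simp [padZero, hj, addrPrefix]
  have a1 := approx ν hν
  have a2 := approx cantorMeasure ae_code_address
  rw [abs_le] at *
  constructor <;> linarith [a1.1, a1.2, a2.1, a2.2, key.1, key.2]

lemma sum_tail_geometric_le (k m : ℕ) :
    ∑ j ∈ Finset.range m, (if k ≤ j then (1 / 2 : ℝ) ^ (j + 1) else 0) ≤ (1 / 2) ^ k := by
  have h : (k ≤ m → ∑ j ∈ Finset.range m, (if k ≤ j then (1 / 2 : ℝ) ^ (j + 1) else 0) =
      (1 / 2) ^ k - (1 / 2) ^ m) := by
    intro hkm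
    induction m, hkm using Nat.le_induction with
    | base =>
      rw [sub_self]
      exact Finset.sum_eq_zero fun j hj => if_neg (not_le.2 (Finset.mem_range.1 hj))
    | succ m hm ih =>
      rw [Finset.sum_range_succ, ih, if_pos hm, pow_succ]
      ring
  rcases le_total k m with hkm | hkm
  · rw [h hkm]
    have : (0 : ℝ) < (1 / 2) ^ m := by positivity
    linarith
  · rw [Finset.sum_eq_zero fun j hj => if_neg (not_le.2 ((Finset.mem_range.1 hj).trans_le hkm))]
    positivity

/-- The test function is adapted to `ν`: at each level it takes the sign of the deviation of the
cylinder containing the point, so that pairing it with the difference of the measures yields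
absolute values at all levels at once. -/
lemma sum_cylDev_le_W (ν : Measure unitSquare) [IsProbabilityMeasure ν]
    (hν : ∀ᵐ x ∂ν, code (address x) = x) (m : ℕ) :
    ∑ k ∈ Finset.range m, 1 / 4 * (1 / 2) ^ (k + 1) * cylDev (k + 1) ν ≤
      W (1 / 2) ν cantorMeasure := by
  set ε : (k : ℕ) → (Fin k → Fin 4) → ℝ := fun k u =>
    (SignType.sign (ν.real (addrPrefix k ⁻¹' {u}) - (1 / 4) ^ k) : ℝ) with hε
  have hε1 (k : ℕ) (u : Fin k → Fin 4) : |ε k u| ≤ 1 := by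
    simp only [hε]
    rcases SignType.sign (ν.real (addrPrefix k ⁻¹' {u}) - (1 / 4) ^ k) with _ | _ | _ <;> simp
  set g : (ℕ → Fin 4) → ℝ := fun w =>
    ∑ k ∈ Finset.range m, 1 / 4 * (1 / 2) ^ (k + 1) * ε (k + 1) fun j => w j with hg
  have hgH (w w' : ℕ → Fin 4) : g w - g w' ≤ √(dist (code w) (code w')) := by
    by_cases hw : w = w'
    · subst hw
      simp
    have hex : ∃ k, w k ≠ w' k := Function.ne_iff.1 hw
    have hk := Nat.find_spec hex
    have hlt : ∀ j < Nat.find hex, w j = w' j := fun j hj => not_not.1 (Nat.find_min hex hj)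
    set k := Nat.find hex
    have hd := le_dist_code hlt hk
    have h2 : 1 / 2 * (1 / 2) ^ k ≤ √(dist (code w) (code w')) := by
      refine Real.le_sqrt_of_sq_le ?_
      rw [mul_pow, ← pow_mul, mul_comm k, pow_mul]
      norm_num at hd ⊢
      have : (0 : ℝ) < (1 / 4) ^ k := by positivity
      linarith
    refine le_trans ?_ h2
    rw [hg, ← Finset.sum_sub_distrib]
    -- Terms with `j < k` read only the common letters and cancel. The others differ by at most
    -- twice their weight `1 / 4 * (1 / 2) ^ (j + 1)`, and the geometric tail sums to at most `(1 /
    -- 2) ^ k`.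
    refine le_trans (Finset.sum_le_sum (g := fun j =>
      1 / 2 * (if k ≤ j then (1 / 2 : ℝ) ^ (j + 1) else 0)) fun j _ => ?_) ?_
    · split_ifs with hj
      · have h3 := abs_le.1 (hε1 (j + 1) fun i => w i)
        have h4 := abs_le.1 (hε1 (j + 1) fun i => w' i)
        have : (0 : ℝ) < (1 / 2) ^ (j + 1) := by positivity
        nlinarith [h3.2, h4.1]
      · have : (fun i : Fin (j + 1) => w i) = fun i : Fin (j + 1) => w' i := by
          funext i
          exact hlt i (by have := i.2; omega)
        rw [this]
        simp
    · rw [← Finset.mul_sum]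
      exact mul_le_mul_of_nonneg_left (sum_tail_geometric_le k m) (by norm_num)
  obtain ⟨f, hf, hfg⟩ := exists_mem_Hol_extension code g hgH
  have e (ρ : Measure unitSquare) [IsProbabilityMeasure ρ] (hρ : ∀ᵐ x ∂ρ, code (address x) = x) :
      ∫ x, f x ∂ρ = ∑ k ∈ Finset.range m,
        1 / 4 * (1 / 2) ^ (k + 1) * ∫ x, ε (k + 1) (addrPrefix (k + 1) x) ∂ρ := by
    have : ∫ x, f x ∂ρ = ∫ x, ∑ k ∈ Finset.range m,
        1 / 4 * (1 / 2) ^ (k + 1) * ε (k + 1) (addrPrefix (k + 1) x) ∂ρ := by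
      refine integral_congr_ae ?_
      filter_upwards [hρ] with x hx
      nth_rw 1 [← hx]
      rw [hfg]
      rfl
    rw [this, integral_finsetSum _ fun k _ => (integrable_comp_addrPrefix _ ρ).const_mul _]
    simp only [integral_const_mul]
  refine le_trans (le_of_eq ?_) ((le_abs_self _).trans (le_W hf ν cantorMeasure))
  rw [e ν hν, e cantorMeasure ae_code_address, ← Finset.sum_sub_distrib]
  refine Finset.sum_congr rfl fun k _ => ?_
  rw [← mul_sub, integral_comp_addrPrefix_sub, cylDev]
  simp only [hε, self_mul_sign]

/-! ### The empirical measure -/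

lemma isProbabilityMeasure_empirical {n : ℕ} (hn : n ≠ 0) (x : ℕ → unitSquare) :
    IsProbabilityMeasure (empirical n x) := by
  constructor
  simp only [empirical, Measure.smul_apply, Measure.finsetSum_apply, measure_univ,
    Finset.sum_const, Nat.card_Icc, smul_eq_mul, nsmul_eq_mul, mul_one, Nat.add_sub_cancel]
  exact ENNReal.inv_mul_cancel (by simpa using hn) (by simp)

lemma integral_empirical (n : ℕ) (x : ℕ → unitSquare) (f : unitSquare → ℝ) :
    ∫ y, f y ∂(empirical n x) = (n : ℝ)⁻¹ * ∑ k ∈ Finset.Icc 1 n, f (x k) := by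
  rw [empirical, integral_smul_measure, integral_finsetSum_measure fun k _ => integrable_dirac (by simp)]
  simp

lemma ae_empirical {n : ℕ} {x : ℕ → unitSquare} {p : unitSquare → Prop} (h : ∀ k, p (x k)) :
    ∀ᵐ y ∂(empirical n x), p y := by
  rw [ae_iff, empirical]
  simp [h]

lemma empirical_real_sub {n : ℕ} (hn : n ≠ 0) (x : ℕ → unitSquare) {A : Set unitSquare}
    (hA : MeasurableSet A) (p : ℝ) :
    (empirical n x).real A - p =
      (n : ℝ)⁻¹ * ∑ k ∈ Finset.Icc 1 n, (A.indicator (fun _ => (1 : ℝ)) (x k) - p) := by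
  have hn' : (n : ℝ) ≠ 0 := Nat.cast_ne_zero.2 hn
  have h := integral_empirical n x (A.indicator fun _ => (1 : ℝ))
  rw [integral_indicator_const _ hA, smul_eq_mul, mul_one] at h
  rw [h, Finset.sum_sub_distrib, Finset.sum_const, Nat.card_Icc, Nat.add_sub_cancel, nsmul_eq_mul,
    mul_sub, inv_mul_cancel_left₀ hn']

/-- Moving the sample points changes the distance by at most their mean displacement in the metric
`√dist`. The resulting continuity in the sample gives measurability of `W`, although it is a
supremum over an uncountable family. -/
lemma W_empirical_le_add {n : ℕ} (hn : n ≠ 0) (x y : ℕ → unitSquare) :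
    W (1 / 2) (empirical n x) cantorMeasure ≤ W (1 / 2) (empirical n y) cantorMeasure +
      (n : ℝ)⁻¹ * ∑ k ∈ Finset.Icc 1 n, √(dist (x k) (y k)) := by
  have := isProbabilityMeasure_empirical hn x
  have := isProbabilityMeasure_empirical hn y
  refine W_le fun f hf => ?_
  have h1 := le_W hf (empirical n y) cantorMeasure
  have h2 : |∫ z, f z ∂(empirical n x) - ∫ z, f z ∂(empirical n y)| ≤
      (n : ℝ)⁻¹ * ∑ k ∈ Finset.Icc 1 n, √(dist (x k) (y k)) := by
    rw [integral_empirical, integral_empirical, ← mul_sub, ← Finset.sum_sub_distrib, abs_mul,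
      abs_of_nonneg (by positivity : (0 : ℝ) ≤ (n : ℝ)⁻¹)]
    refine mul_le_mul_of_nonneg_left ?_ (by positivity)
    exact (Finset.abs_sum_le_sum_abs _ _).trans
      (Finset.sum_le_sum fun k _ => mem_Hol_half.1 hf _ _)
  have h3 := abs_sub_le (∫ z, f z ∂(empirical n x)) (∫ z, f z ∂(empirical n y))
    (∫ z, f z ∂cantorMeasure)
  linarith

lemma continuous_W_empirical {n : ℕ} (hn : n ≠ 0) :
    Continuous fun x : ℕ → unitSquare => W (1 / 2) (empirical n x) cantorMeasure := by
  rw [continuous_iff_continuousAt]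
  intro y
  rw [ContinuousAt, tendsto_iff_dist_tendsto_zero]
  have hc : Continuous fun x : ℕ → unitSquare =>
      (n : ℝ)⁻¹ * ∑ k ∈ Finset.Icc 1 n, √(dist (x k) (y k)) := by fun_prop
  have := hc.tendsto y
  simp only [dist_self, Real.sqrt_zero, Finset.sum_const_zero, mul_zero] at this
  refine squeeze_zero (fun x => dist_nonneg) (fun x => ?_) this
  have h1 := W_empirical_le_add hn x y
  have h2 := W_empirical_le_add hn y x
  simp only [dist_comm (y _) (x _)] at h2
  rw [Real.dist_eq, abs_sub_le_iff]
  constructor <;> linarith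

/-! ### Expectations -/

section Expectation

variable {Ω : Type*} [MeasurableSpace Ω] {P : Measure Ω} [IsProbabilityMeasure P]
  {X : ℕ → Ω → unitSquare}

lemma integrable_W_empirical (hX : ∀ k, AEMeasurable (X k) P) {n : ℕ} (hn : n ≠ 0) :
    Integrable (fun ω => W (1 / 2) (empirical n fun k => X k ω) cantorMeasure) P := by
  have hm : AEMeasurable (fun ω => W (1 / 2) (empirical n fun k => X k ω) cantorMeasure) P :=
    (continuous_W_empirical hn).measurable.comp_aemeasurable (aemeasurable_pi_lambda _ hX)
  refine Integrable.of_bound hm.aestronglyMeasurable 4 (Filter.Eventually.of_forall fun ω => ?_)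
  have := isProbabilityMeasure_empirical hn fun k => X k ω
  rw [Real.norm_of_nonneg (W_nonneg _ _ _)]
  exact W_le fun f hf => abs_integral_sub_integral_le hf _ _

/-- The mean deviation of the empirical measure of a set `A` of measure `p`. -/
lemma integral_abs_empirical_sub (hX : ∀ k, HasLaw (X k) cantorMeasure P) (hind : iIndepFun X P)
    {n : ℕ} (hn : n ≠ 0) {A : Set unitSquare} (hA : MeasurableSet A) {p : ℝ}
    (hp : cantorMeasure.real A = p) :
    Integrable (fun ω => |(empirical n fun k => X k ω).real A - p|) P ∧
      ∫ ω, |(empirical n fun k => X k ω).real A - p| ∂P ≤ (n : ℝ)⁻¹ * √(n * (p * (1 - p))) ∧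
      (1 / 6 ≤ n * (p * (1 - p)) → (n : ℝ)⁻¹ * (√(n * (p * (1 - p))) / 10) ≤
        ∫ ω, |(empirical n fun k => X k ω).real A - p| ∂P) := by
  have hp0 : 0 ≤ p := hp ▸ measureReal_nonneg
  have hp1 : p ≤ 1 := hp ▸ measureReal_le_one
  set φ : unitSquare → ℝ := fun x => A.indicator (fun _ => (1 : ℝ)) x - p with hφ
  have hφm : Measurable φ := (measurable_const.indicator hA).sub_const p
  have hφb (x : unitSquare) : |φ x| ≤ 1 := by
    by_cases hx : x ∈ A
    · simp only [hφ, Set.indicator_of_mem hx, abs_le]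
      constructor <;> linarith
    · simp only [hφ, Set.indicator_of_notMem hx, abs_le]
      constructor <;> linarith
  have hZm (k : ℕ) : AEMeasurable (fun ω => φ (X k ω)) P :=
    hφm.comp_aemeasurable (hX k).aemeasurable
  have hI : ∫ x, A.indicator (fun _ => (1 : ℝ)) x ∂cantorMeasure = p := by
    rw [integral_indicator_const _ hA, hp, smul_eq_mul, mul_one]
  have hInt : Integrable (A.indicator fun _ => (1 : ℝ)) cantorMeasure :=
    (integrable_const _).indicator hA
  have h1 (k : ℕ) : ∫ ω, φ (X k ω) ∂P = 0 := by
    have := (hX k).integral_comp (f := φ) hφm.aestronglyMeasurable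
    simp only [Function.comp_def] at this
    rw [this, hφ, integral_sub hInt (integrable_const _), hI]
    simp
  have h2 (k : ℕ) : ∫ ω, φ (X k ω) ^ 2 ∂P = p * (1 - p) := by
    have := (hX k).integral_comp (f := fun x => φ x ^ 2) (hφm.pow_const 2).aestronglyMeasurable
    simp only [Function.comp_def] at this
    rw [this]
    -- An indicator equals its own square, so the square of `φ` is affine in it.
    have e (x : unitSquare) : φ x ^ 2 = (1 - 2 * p) * A.indicator (fun _ => (1 : ℝ)) x + p ^ 2 := by
      by_cases hx : x ∈ A
      · simp only [hφ, Set.indicator_of_mem hx]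
        ring
      · simp only [hφ, Set.indicator_of_notMem hx]
        ring
    simp only [e]
    rw [integral_add (hInt.const_mul _) (integrable_const _), integral_const_mul, hI]
    simp
    ring
  have hindZ : iIndepFun (fun k ω => φ (X k ω)) P := hind.comp (fun _ => φ) fun _ => hφm
  have hb := integral_abs_sum_bounds hZm hindZ (fun k ω => hφb _) h1 h2 (Finset.Icc 1 n)
  rw [Nat.card_Icc, Nat.add_sub_cancel] at hb
  have hn0 : (0 : ℝ) ≤ (n : ℝ)⁻¹ := by positivity
  have e (ω : Ω) : |(empirical n fun k => X k ω).real A - p| =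
      (n : ℝ)⁻¹ * |∑ k ∈ Finset.Icc 1 n, φ (X k ω)| := by
    rw [empirical_real_sub hn _ hA, abs_mul, abs_of_nonneg hn0]
  simp only [e, integral_const_mul]
  refine ⟨?_, mul_le_mul_of_nonneg_left hb.1 hn0, fun h => mul_le_mul_of_nonneg_left (hb.2 h) hn0⟩
  refine (Integrable.abs ?_).const_mul _
  refine integrable_finsetSum _ fun k _ => ?_
  simpa using integrable_pow_of_abs_le (hZm k) (fun ω => hφb _) 1

/-- Each of the `4 ^ k` cylinders has probability `p = 4 ^ (-k)` and mean deviation of order `√(p /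
n) = 2 ^ (-k) / √n`. The lower bound needs an expected count `n * p` bounded below, which is the
condition `4 ^ k ≤ 4 * n`. -/
lemma integral_cylDev_empirical (hX : ∀ k, HasLaw (X k) cantorMeasure P) (hind : iIndepFun X P)
    {n : ℕ} (hn : n ≠ 0) (k : ℕ) :
    Integrable (fun ω => cylDev k (empirical n fun j => X j ω)) P ∧
      ∫ ω, cylDev k (empirical n fun j => X j ω) ∂P ≤ 2 ^ k / √n ∧
      (1 ≤ k → 4 ^ k ≤ 4 * n → 2 ^ k / (20 * √n) ≤
        ∫ ω, cylDev k (empirical n fun j => X j ω) ∂P) := by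
  have key (u : Fin k → Fin 4) := integral_abs_empirical_sub hX hind hn
    (measurable_addrPrefix k (measurableSet_singleton u)) (cantorMeasure_addrPrefix k u)
  have hn1 : (0 : ℝ) < n := by positivity
  have hs : 0 < √(n : ℝ) := Real.sqrt_pos.2 hn1
  have hss : √(n : ℝ) * √n = n := Real.mul_self_sqrt hn1.le
  set p : ℝ := (1 / 4) ^ k with hp
  have hp0 : 0 < p := by positivity
  have hcard : (Fintype.card (Fin k → Fin 4) : ℝ) = 2 ^ k * 2 ^ k := by
    rw [Fintype.card_fun, Fintype.card_fin, Fintype.card_fin, ← mul_pow]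
    norm_num
  have h22 : (2 : ℝ) ^ k * (1 / 2) ^ k = 1 := by
    rw [← mul_pow]
    norm_num
  have hsp : √(n * p) = √n * (1 / 2) ^ k := by
    rw [Real.sqrt_mul hn1.le, hp, sqrt_quarter_pow]
  have hninv : (n : ℝ)⁻¹ * √n = 1 / √n := by
    rw [eq_div_iff hs.ne', mul_assoc, hss, inv_mul_cancel₀ hn1.ne']
  unfold cylDev
  refine ⟨integrable_finsetSum _ fun u _ => (key u).1, ?_, fun hk hkn => ?_⟩
  · rw [integral_finsetSum _ fun u _ => (key u).1]
    have hu (u : Fin k → Fin 4) : ∫ ω, |(empirical n fun j => X j ω).real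
        (addrPrefix k ⁻¹' {u}) - p| ∂P ≤ 1 / √n * (1 / 2) ^ k := by
      refine (key u).2.1.trans ?_
      rw [← hninv, mul_assoc, ← hsp]
      refine mul_le_mul_of_nonneg_left (Real.sqrt_le_sqrt ?_) (by positivity)
      nlinarith [mul_nonneg hn1.le (sq_nonneg p)]
    refine (Finset.sum_le_sum fun u _ => hu u).trans (le_of_eq ?_)
    rw [Finset.sum_const, Finset.card_univ, nsmul_eq_mul, hcard]
    calc 2 ^ k * 2 ^ k * (1 / √n * (1 / 2) ^ k) = 2 ^ k / √n * (2 ^ k * (1 / 2) ^ k) := by ring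
      _ = 2 ^ k / √n := by rw [h22, mul_one]
  · rw [integral_finsetSum _ fun u _ => (key u).1]
    have hp4 : p ≤ 1 / 4 := by
      rw [hp]
      simpa using pow_le_pow_of_le_one (by norm_num : (0 : ℝ) ≤ 1 / 4) (by norm_num) hk
    have hnp : 1 / 4 ≤ n * p := by
      have h4 : (4 : ℝ) ^ k * p = 1 := by
        rw [hp, ← mul_pow]
        norm_num
      have h5 : (4 : ℝ) ^ k ≤ 4 * n := by exact_mod_cast hkn
      nlinarith
    have hv : n * p / 4 ≤ n * (p * (1 - p)) := by nlinarith
    -- From `p ≤ 1/4` and `n * p ≥ 1/4` the variance is at least `3/16`, above the threshold `1/6`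
    -- of the moment bound.
    have hv6 : 1 / 6 ≤ n * (p * (1 - p)) := by nlinarith
    have hu (u : Fin k → Fin 4) : 1 / (20 * √n) * (1 / 2) ^ k ≤ ∫ ω, |(empirical n fun j =>
        X j ω).real (addrPrefix k ⁻¹' {u}) - p| ∂P := by
      refine le_trans ?_ ((key u).2.2 hv6)
      have h6 : √(n * p) / 2 ≤ √(n * (p * (1 - p))) := by
        refine Real.le_sqrt_of_sq_le ?_
        rw [div_pow, Real.sq_sqrt (by positivity)]
        linarith
      calc 1 / (20 * √n) * (1 / 2) ^ k = 1 / √n * (1 / 2) ^ k / 20 := by ring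
        _ = (n : ℝ)⁻¹ * (√(n * p) / 2 / 10) := by
          rw [hsp, ← hninv]
          ring
        _ ≤ _ := by gcongr
    refine le_trans (le_of_eq ?_) (Finset.sum_le_sum fun u _ => hu u)
    rw [Finset.sum_const, Finset.card_univ, nsmul_eq_mul, hcard]
    calc 2 ^ k / (20 * √n) = 2 ^ k / (20 * √n) * (2 ^ k * (1 / 2) ^ k) := by rw [h22, mul_one]
      _ = _ := by ring

/-- The weight `(1 / 2) ^ k` cancels the size `2 ^ k / √n` of the deviations, so each of the `m`
levels contributes the same order `1 / √n` in both directions. -/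
lemma integral_W_empirical_bounds (hX : ∀ k, HasLaw (X k) cantorMeasure P) (hind : iIndepFun X P)
    {n : ℕ} (hn : n ≠ 0) (m : ℕ) :
    (4 ^ m ≤ 4 * n → m / (80 * √n) ≤
      ∫ ω, W (1 / 2) (empirical n fun k => X k ω) cantorMeasure ∂P) ∧
    ∫ ω, W (1 / 2) (empirical n fun k => X k ω) cantorMeasure ∂P ≤
      4 * m / √n + 4 * (1 / 2) ^ m := by
  have hW := integrable_W_empirical (P := P) (fun k => (hX k).aemeasurable) hn
  have hD := integral_cylDev_empirical hX hind hn
  -- Almost surely all the sample points are points of their own addresses, so the tree comparison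
  -- applies to the empirical measure itself.
  have hgood : ∀ᵐ ω ∂P, ∀ k, code (address (X k ω)) = X k ω := by
    rw [ae_all_iff]
    intro k
    have := ae_code_address
    rw [← (hX k).map_eq] at this
    exact ae_of_ae_map (hX k).aemeasurable this
  have hpr (x : ℕ → unitSquare) := isProbabilityMeasure_empirical hn x
  have h22 (k : ℕ) : (2 : ℝ) ^ k * (1 / 2) ^ k = 1 := by
    rw [← mul_pow]
    norm_num
  constructor
  · intro hm
    have h : ∫ ω, ∑ k ∈ Finset.range m, 1 / 4 * (1 / 2) ^ (k + 1) *
        cylDev (k + 1) (empirical n fun j => X j ω) ∂P ≤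
        ∫ ω, W (1 / 2) (empirical n fun k => X k ω) cantorMeasure ∂P := by
      refine integral_mono_ae (integrable_finsetSum _ fun k _ => (hD (k + 1)).1.const_mul _) hW ?_
      filter_upwards [hgood] with ω hω
      exact sum_cylDev_le_W _ (ae_empirical hω) m
    refine le_trans ?_ h
    rw [integral_finsetSum _ fun k _ => (hD (k + 1)).1.const_mul _]
    have hk : ∀ k ∈ Finset.range m, 1 / (80 * √n) ≤ ∫ ω, 1 / 4 * (1 / 2) ^ (k + 1) *
        cylDev (k + 1) (empirical n fun j => X j ω) ∂P := by
      intro k hk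
      rw [integral_const_mul]
      have h4 : 4 ^ (k + 1) ≤ 4 * n :=
        (Nat.pow_le_pow_right (by norm_num) (Finset.mem_range.1 hk)).trans hm
      calc 1 / (80 * √n) = 1 / (80 * √n) * (2 ^ (k + 1) * (1 / 2) ^ (k + 1)) := by
            rw [h22, mul_one]
        _ = 1 / 4 * (1 / 2) ^ (k + 1) * (2 ^ (k + 1) / (20 * √n)) := by ring
        _ ≤ _ := mul_le_mul_of_nonneg_left ((hD (k + 1)).2.2 (by omega) h4) (by positivity)
    refine le_trans (le_of_eq ?_) (Finset.sum_le_sum hk)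
    rw [Finset.sum_const, Finset.card_range, nsmul_eq_mul]
    ring
  · have hint : Integrable (fun ω => ∑ k ∈ Finset.range m, 2 * (1 / 2) ^ k *
        cylDev (k + 1) (empirical n fun j => X j ω)) P :=
      integrable_finsetSum _ fun k _ => (hD (k + 1)).1.const_mul _
    have h : ∫ ω, W (1 / 2) (empirical n fun k => X k ω) cantorMeasure ∂P ≤
        ∫ ω, (∑ k ∈ Finset.range m, 2 * (1 / 2) ^ k *
          cylDev (k + 1) (empirical n fun j => X j ω) + 4 * (1 / 2) ^ m) ∂P := by
      refine integral_mono_ae hW (hint.fun_add (integrable_const _)) ?_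
      filter_upwards [hgood] with ω hω
      exact W_le_sum_cylDev _ (ae_empirical hω) m
    refine h.trans ?_
    rw [integral_add hint (integrable_const _),
      integral_finsetSum _ fun k _ => (hD (k + 1)).1.const_mul _, integral_const, probReal_univ,
      one_smul]
    have hk : ∀ k ∈ Finset.range m, ∫ ω, 2 * (1 / 2) ^ k *
        cylDev (k + 1) (empirical n fun j => X j ω) ∂P ≤ 4 / √n := by
      intro k hk
      rw [integral_const_mul]
      calc 2 * (1 / 2) ^ k * ∫ ω, cylDev (k + 1) (empirical n fun j => X j ω) ∂P
          ≤ 2 * (1 / 2) ^ k * (2 ^ (k + 1) / √n) :=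
            mul_le_mul_of_nonneg_left (hD (k + 1)).2.1 (by positivity)
        _ = 4 / √n * (2 ^ k * (1 / 2) ^ k) := by ring
        _ = 4 / √n := by rw [h22, mul_one]
    have hsum := Finset.sum_le_sum hk
    rw [Finset.sum_const, Finset.card_range, nsmul_eq_mul] at hsum
    have e : 4 * (m : ℝ) / √n = m * (4 / √n) := by ring
    rw [e]
    linarith

end Expectation

end FourCorners

/-! ### Choice of the number of scales -/

theorem mainTheorem7 :
    ∃ c C : ℝ, 0 < c ∧ 0 < C ∧
      ∀ (Ω : Type*) [MeasurableSpace Ω] (P : Measure Ω) [IsProbabilityMeasure P]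
        (X : ℕ → Ω → FourCorners.unitSquare),
        (∀ k, HasLaw (X k) FourCorners.cantorMeasure P) → iIndepFun X P →
        ∀ n : ℕ, 2 ≤ n →
          Integrable (fun ω => FourCorners.W (1 / 2)
            (FourCorners.empirical n (fun k => X k ω)) FourCorners.cantorMeasure) P ∧
          c * (Real.log n / √n) ≤
            ∫ ω, FourCorners.W (1 / 2)
              (FourCorners.empirical n (fun k => X k ω)) FourCorners.cantorMeasure ∂P ∧
          ∫ ω, FourCorners.W (1 / 2)
              (FourCorners.empirical n (fun k => X k ω)) FourCorners.cantorMeasure ∂P ≤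
            C * (Real.log n / √n) := by
  refine ⟨1 / 160, 20, by norm_num, by norm_num, fun Ω _ P _ X hX hind n hn => ?_⟩
  have hn0 : n ≠ 0 := by omega
  have hnpos : (0 : ℝ) < n := by positivity
  have hs : 0 < √(n : ℝ) := Real.sqrt_pos.2 hnpos
  -- The depth `m = Nat.log 4 n + 1` satisfies `n < 4 ^ m ≤ 4 * n`: the upper inequality is what the
  -- lower bound requires, and the lower one makes the truncation error at most `4 / √n`.
  obtain ⟨hlow, hup⟩ := FourCorners.integral_W_empirical_bounds hX hind hn0 (Nat.log 4 n + 1)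
  have hlog4 : Real.log 4 = 2 * Real.log 2 := by
    rw [show (4 : ℝ) = 2 ^ 2 by norm_num, Real.log_pow]
    norm_num
  have hl1 := Real.log_two_gt_d9
  have hl2 := Real.log_two_lt_d9
  have hpow1 : 4 ^ Nat.log 4 n ≤ n := Nat.pow_log_le_self 4 hn0
  have hpow2 : n < 4 ^ (Nat.log 4 n + 1) := Nat.lt_pow_succ_log_self (by norm_num) n
  have hpow1' : ((4 : ℝ)) ^ Nat.log 4 n ≤ n := by exact_mod_cast hpow1
  have hpow2' : (n : ℝ) ≤ 4 ^ (Nat.log 4 n + 1) := by exact_mod_cast hpow2.le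
  have hlogn : Real.log 2 ≤ Real.log n := Real.log_le_log (by norm_num) (by exact_mod_cast hn)
  have h1 := Real.log_le_log (by positivity) hpow1'
  have h2 := Real.log_le_log hnpos hpow2'
  rw [Real.log_pow, hlog4] at h1 h2
  set m : ℕ := Nat.log 4 n
  have hm0 : (0 : ℝ) ≤ m := Nat.cast_nonneg m
  refine ⟨FourCorners.integrable_W_empirical (fun k => (hX k).aemeasurable) hn0,
    le_trans ?_ (hlow ?_), hup.trans ?_⟩
  · rw [show 1 / 160 * (Real.log n / √n) = Real.log n / 2 / (80 * √n) by ring]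
    refine div_le_div_of_nonneg_right ?_ (by positivity)
    push_cast at h2 ⊢
    -- Here `log n ≤ 2 * (m + 1) * log 2` and `log 2 < 1`, so `log n / 2 ≤ m + 1`; this halving
    -- turns `80` into `160`.
    nlinarith
  · rw [pow_succ, mul_comm]
    exact Nat.mul_le_mul_left 4 hpow1
  · have h3 : (1 / 2 : ℝ) ^ (m + 1) ≤ 1 / √n := by
      rw [← FourCorners.sqrt_quarter_pow, ← Real.sqrt_one, ← Real.sqrt_div zero_le_one, Real.sqrt_one]
      refine Real.sqrt_le_sqrt ?_
      rw [one_div_pow]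
      exact one_div_le_one_div_of_le hnpos hpow2'
    calc 4 * ((m + 1 : ℕ) : ℝ) / √n + 4 * (1 / 2) ^ (m + 1)
        ≤ 4 * ((m + 1 : ℕ) : ℝ) / √n + 4 * (1 / √n) := by gcongr
      _ = 4 * (m + 2) / √n := by
        push_cast
        ring
      _ ≤ 20 * Real.log n / √n := by
        refine div_le_div_of_nonneg_right ?_ hs.le
        -- From `2 * m * log 2 ≤ log n` and `log 2 ≤ log n`, the quantity `4 * (m + 2)` is at most
        -- `(10 / log 2) * log n`, and `10 / log 2 < 20`. The hypothesis `2 ≤ n` absorbs the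
        -- additive constant.
        nlinarith
      _ = 20 * (Real.log n / √n) := by ring
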